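/- Let $k$ be a (commutative) field, $G$ a group, and $\mathcal{L}$ a local system of $G$, that is, an upwardly directed collection of subgroups of $G$ whose union is $G$. $G$-modules are $k$-linear representations of $G$; for a $G$-module $V$, $V^\vee$ denotes its dual with the contragredient action, $[V,G]$ the submodule spanned by all $gv-v$ ($g\in G$, $v\in V$), and $C_V(G)$ the submodule of $G$-fixed vectors. Let $0\to V\xrightarrow{\iota} W\xrightarrow{\pi} Q\to 0$ be an exact sequence of $G$-modules, where $V$ is arbitrary (for example, finitary) and $G$ acts trivially on $Q$. Suppose that the extension is locally split: for every $L\in\mathcal{L}$, $\pi$ has an $L$-equivariant $k$-linear section. Then: (1) The extension is represented in the double dual: there is a $G$-homomorphism $\varphi: W\to V^{\vee\vee}$ that extends the canonical embedding of $V$ in its double dual, i.e. $\varphi(\iota(v))(\lambda)=\lambda(v)$ for all $v\in V$, $\lambda\in V^\vee$. (2) There is a canonical injection $W/C_W(G)\hookrightarrow [V^\vee,G]^\vee$: there is a unique injective $G$-homomorphism $\psi: W/C_W(G)\to [V^\vee,G]^\vee$ such that, for every $\varphi$ as in (1) and every $w\in W$, $\psi(w+C_W(G))$ is the restriction of $\varphi(w)$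 to $[V^\vee,G]$. -/

import Mathlib

namespace LocalCohomology

/-- A local system of a group: an upwardly directed collection of subgroups whose union is the
whole group. -/
structure IsLocalSystem {G : Type*} [Group G] (𝓛 : Set (Subgroup G)) : Prop where
  directed : DirectedOn (· ≤ ·) 𝓛
  exists_mem : ∀ g : G, ∃ L ∈ 𝓛, g ∈ L

section

variable {k G V W Q : Type*} [Field k] [Group G] [AddCommGroup V] [Module k V]
  [AddCommGroup W] [Module k W] [AddCommGroup Q] [Module k Q]

/-- `0 → V → W → Q → 0` is an exact sequence of `G`-modules: `W` is an extension of `V` by `Q`. -/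
structure IsExtension {ρ : Representation k G V} {σ : Representation k G W}
    {τ : Representation k G Q} (ι : ρ.IntertwiningMap σ) (π : σ.IntertwiningMap τ) : Prop where
  injective : Function.Injective ι
  exact : Function.Exact ι π
  surjective : Function.Surjective π

/-- The surjection `π : W → Q` of `G`-modules splits over the subgroup `L`: it has a section that
is a homomorphism of `L`-modules. -/
def SplitsOver {σ : Representation k G W} {τ : Representation k G Q}
    (π : σ.IntertwiningMap τ) (L : Subgroup G) : Prop :=
  ∃ s : Representation.IntertwiningMap (τ.comp L.subtype) (σ.comp L.subtype),
    ∀ q : Q, π (s q) = q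

/-- The surjection `π : W → Q` of `G`-modules is locally split with respect to `𝓛`. -/
def LocallySplit {σ : Representation k G W} {τ : Representation k G Q}
    (π : σ.IntertwiningMap τ) (𝓛 : Set (Subgroup G)) : Prop :=
  ∀ L ∈ 𝓛, SplitsOver π L

/-- The fixed space `C_W(G)`. -/
noncomputable abbrev fixedSpace (σ : Representation k G W) : Submodule k W := σ.invariants

/-- The commutator space `[V, G]`, spanned by the vectors `g v - v`. -/
abbrev commutatorSpace (ρ : Representation k G V) : Submodule k V :=
  Representation.Coinvariants.ker ρ

theorem fixedSpace_le_comap (σ : Representation k G W) (g : G) :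
    fixedSpace σ ≤ (fixedSpace σ).comap (σ g) := by
  intro w hw
  rw [Submodule.mem_comap, hw g]
  exact hw

theorem commutatorSpace_le_comap (ρ : Representation k G V) (g : G) :
    commutatorSpace ρ ≤ (commutatorSpace ρ).comap (ρ g) := by
  intro v hv
  rw [Submodule.mem_comap]
  have h := Submodule.add_mem _ (Representation.Coinvariants.sub_mem_ker (ρ := ρ) g v) hv
  rwa [sub_add_cancel] at h

/-- The `G`-module `W / C_W(G)`. -/
noncomputable abbrev modFixedSpace (σ : Representation k G W) : Representation k G (W ⧸ fixedSpace σ) :=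
  σ.quotient (fixedSpace σ) (fixedSpace_le_comap σ)

/-- The `G`-module `[V, G]`. -/
noncomputable abbrev commutatorRep (ρ : Representation k G V) : Representation k G (commutatorSpace ρ) :=
  ρ.subrepresentation (commutatorSpace ρ) (commutatorSpace_le_comap ρ)

/-- The `G`-homomorphism `φ : W → V^∨∨` extends, along `ι : V → W`, the canonical embedding of `V` in its
double dual. -/
def ExtendsEval {ρ : Representation k G V} {σ : Representation k G W}
    (ι : ρ.IntertwiningMap σ) (φ : σ.IntertwiningMap ρ.dual.dual) : Prop :=
  ∀ v : V, φ (ι v) = Module.Dual.eval k V v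

end

end LocalCohomology

open LocalCohomology

/-!
A `G`-homomorphism `W → V^∨∨` is the same thing as a `G`-homomorphism `V^∨ → W^∨`, and it extends the
canonical embedding of `V` exactly when the latter is a section of the restriction map `W^∨ → V^∨`.
A surjection of `G`-modules splits as soon as its kernel meets the commutator space trivially: any
complement of the kernel that contains the commutator space is automatically `G`-stable. Here, an
element of `[W^∨, G]` lies in `[W^∨, L]` for some `L ∈ 𝓛`, so it annihilates `C_W(L)`; if it also
vanishes on `V`, it is zero, because the splitting over `L` gives `W = V + C_W(L)`.

Every such section maps `[V^∨, G]` isomorphically onto `[W^∨, G]`, inverting the restriction map. So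
all of them agree on `[V^∨, G]`, and the kernel of `W → [V^∨, G]^∨` is the annihilator in `W` of
`[W^∨, G]`, which is `C_W(G)`.
-/

namespace LocalCohomology

section

variable {k G V W Q : Type*} [Field k] [Group G] [AddCommGroup V] [Module k V]
  [AddCommGroup W] [Module k W] [AddCommGroup Q] [Module k Q]
  {ρ : Representation k G V} {σ : Representation k G W} {τ : Representation k G Q}

theorem apply_mem_commutatorSpace (f : ρ.IntertwiningMap σ) {v : V} (hv : v ∈ commutatorSpace ρ) :
    f v ∈ commutatorSpace σ := by
  suffices commutatorSpace ρ ≤ (commutatorSpace σ).comap f.toLinearMap from this hv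
  refine Submodule.span_le.2 ?_
  rintro _ ⟨⟨g, u⟩, rfl⟩
  exact Representation.Coinvariants.mem_ker_of_eq g (f u) _
    (by rw [← f.isIntertwining]; exact (map_sub f _ _).symm)

theorem commutatorSpace_comp_subtype_mono (ρ : Representation k G V) :
    Monotone fun L : Subgroup G => commutatorSpace (ρ.comp L.subtype) := by
  refine fun L₁ L₂ hle => Submodule.span_mono ?_
  rintro _ ⟨⟨g, v⟩, rfl⟩
  exact ⟨(Subgroup.inclusion hle g, v), rfl⟩

theorem IsLocalSystem.exists_mem_commutatorSpace {𝓛 : Set (Subgroup G)} (h𝓛 : IsLocalSystem 𝓛)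
    {v : V} (hv : v ∈ commutatorSpace ρ) :
    ∃ L ∈ 𝓛, v ∈ commutatorSpace (ρ.comp L.subtype) := by
  let S := (fun L : Subgroup G => commutatorSpace (ρ.comp L.subtype)) '' 𝓛
  have hne : S.Nonempty := by
    obtain ⟨L, hL, -⟩ := h𝓛.exists_mem 1
    exact ⟨_, L, hL, rfl⟩
  have hdir : DirectedOn (· ≤ ·) S :=
    directedOn_image.2 (h𝓛.directed.mono' fun _ _ _ _ h => commutatorSpace_comp_subtype_mono ρ h)
  have hle : commutatorSpace ρ ≤ sSup S := by
    refine Submodule.span_le.2 ?_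
    rintro _ ⟨⟨g, u⟩, rfl⟩
    obtain ⟨L, hL, hg⟩ := h𝓛.exists_mem g
    have hLS : commutatorSpace (ρ.comp L.subtype) ≤ sSup S := le_sSup ⟨L, hL, rfl⟩
    exact hLS (Representation.Coinvariants.sub_mem_ker (ρ := ρ.comp L.subtype) (⟨g, hg⟩ : L) u)
  obtain ⟨_, ⟨L, hL, rfl⟩, hvL⟩ := (Submodule.mem_sSup_of_directed hne hdir).1 (hle hv)
  exact ⟨L, hL, hvL⟩

theorem dualCoannihilator_commutatorSpace_dual (σ : Representation k G W) :
    (commutatorSpace σ.dual).dualCoannihilator = fixedSpace σ := by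
  ext w
  rw [Submodule.mem_dualCoannihilator, Representation.mem_invariants]
  constructor
  · intro hw g
    refine sub_eq_zero.1 ((Module.forall_dual_apply_eq_zero_iff k _).1 fun l => ?_)
    have h := hw _ (Representation.Coinvariants.sub_mem_ker (ρ := σ.dual) g⁻¹ l)
    simpa [Representation.dual_apply, Module.Dual.transpose_apply] using h
  · intro hw
    suffices commutatorSpace σ.dual ≤ LinearMap.ker (Module.Dual.eval k W w) from
      fun _ hx => this hx
    refine Submodule.span_le.2 ?_
    rintro _ ⟨⟨g, l⟩, rfl⟩
    simp [Representation.dual_apply, Module.Dual.transpose_apply, hw]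

section EquivariantSection

variable {f : σ.IntertwiningMap τ}

theorem exists_section_of_disjoint_commutatorSpace (hf : Function.Surjective f)
    (hd : Disjoint (commutatorSpace σ) (LinearMap.ker f.toLinearMap)) :
    ∃ s : τ.IntertwiningMap σ, ∀ q, f (s q) = q := by
  obtain ⟨C, hC, hcompl⟩ := hd.exists_isCompl
  have hinj : Set.InjOn f C := LinearMap.injOn_of_disjoint_ker le_rfl hcompl.disjoint
  have hsurj : Function.Surjective (f.toLinearMap.domRestrict C) := by
    intro q
    obtain ⟨w, rfl⟩ := hf q
    obtain ⟨c, hc, u, hu, rfl⟩ := Submodule.mem_sup.1 (hcompl.sup_eq_top.ge (x := w) trivial)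
    have hfu : f u = 0 := hu
    exact ⟨⟨c, hc⟩, by rw [map_add, hfu, add_zero]; rfl⟩
  obtain ⟨s, hs⟩ := LinearMap.exists_rightInverse_of_surjective _ (LinearMap.range_eq_top.2 hsurj)
  have hfs (q : Q) : f (s q) = q := congr($hs q)
  have hstable (g : G) (c : C) : σ g c ∈ C := by
    rw [← sub_add_cancel (σ g c) c]
    exact C.add_mem (hC (Representation.Coinvariants.sub_mem_ker g _)) c.2
  refine ⟨(C.subtype ∘ₗ s).intertwiningMap_of_isIntertwiningMap _ _ fun g q => ?_, hfs⟩
  refine hinj (s (τ g q)).2 (hstable g (s q)) ?_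
  rw [f.isIntertwining]
  exact (hfs _).trans congr(τ g $(hfs q)).symm

theorem section_eqOn_commutatorSpace
    (hd : Disjoint (commutatorSpace σ) (LinearMap.ker f.toLinearMap))
    {s s' : τ.IntertwiningMap σ} (hs : ∀ q, f (s q) = q) (hs' : ∀ q, f (s' q) = q) :
    Set.EqOn s s' (commutatorSpace τ) := fun q hq =>
  LinearMap.injOn_of_disjoint_ker (f := f.toLinearMap) le_rfl hd (apply_mem_commutatorSpace s hq)
    (apply_mem_commutatorSpace s' hq) ((hs q).trans (hs' q).symm)

theorem map_section_commutatorSpace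
    (hd : Disjoint (commutatorSpace σ) (LinearMap.ker f.toLinearMap))
    {s : τ.IntertwiningMap σ} (hs : ∀ q, f (s q) = q) :
    (commutatorSpace τ).map s.toLinearMap = commutatorSpace σ := by
  refine le_antisymm (Submodule.map_le_iff_le_comap.2 fun _ => apply_mem_commutatorSpace s) ?_
  intro w hw
  have hfw : f w ∈ commutatorSpace τ := apply_mem_commutatorSpace f hw
  exact ⟨f w, hfw, LinearMap.injOn_of_disjoint_ker (f := f.toLinearMap) le_rfl hd
    (apply_mem_commutatorSpace s hfw) hw (hs (f w))⟩

end EquivariantSection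

theorem existsUnique_injective_of_ker_eq_fixedSpace {f : σ.IntertwiningMap τ}
    (hf : LinearMap.ker f.toLinearMap = fixedSpace σ) :
    ∃! ψ : (modFixedSpace σ).IntertwiningMap τ,
      Function.Injective ψ ∧ ∀ w : W, ψ (Submodule.Quotient.mk w) = f w := by
  have hmk := Submodule.Quotient.mk_surjective (fixedSpace σ)
  refine ⟨((fixedSpace σ).liftQ f.toLinearMap hf.ge).intertwiningMap_of_isIntertwiningMap _ _
    fun g => hmk.forall.2 (f.isIntertwining _ _ g), ⟨?_, fun _ => rfl⟩, ?_⟩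
  · exact LinearMap.ker_eq_bot.1 (Submodule.ker_liftQ_eq_bot _ _ _ hf.le)
  · rintro ψ ⟨-, hψ⟩
    exact DFunLike.ext _ _ (hmk.forall.2 hψ)

/-- The transpose `W^∨ → V^∨` of a `G`-homomorphism `V → W`. -/
def dualMap (f : ρ.IntertwiningMap σ) : σ.dual.IntertwiningMap ρ.dual :=
  f.toLinearMap.dualMap.intertwiningMap_of_isIntertwiningMap _ _ fun g l =>
    LinearMap.ext fun v => congr(l $(f.isIntertwining _ _ g⁻¹ v)).symm

/-- The `G`-homomorphism `W → V^∨` with the same underlying bilinear form on `V × W` as a given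
`G`-homomorphism `V → W^∨`. -/
def flipDual (f : ρ.IntertwiningMap σ.dual) : σ.IntertwiningMap ρ.dual :=
  f.toLinearMap.flip.intertwiningMap_of_isIntertwiningMap _ _ fun g w => by
    ext v
    have h : f (ρ g⁻¹ v) w = σ.dual g⁻¹ (f v) w := congr($(f.isIntertwining _ _ g⁻¹ v) w)
    simpa [Representation.dual_apply, Module.Dual.transpose_apply] using h.symm

theorem extendsEval_iff_dualMap_flipDual {ι : ρ.IntertwiningMap σ}
    {φ : σ.IntertwiningMap ρ.dual.dual} :
    ExtendsEval ι φ ↔ ∀ l, dualMap ι (flipDual φ l) = l :=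
  ⟨fun h l => LinearMap.ext fun v => congr($(h v) l),
    fun h v => LinearMap.ext fun l => congr($(h l) v)⟩

/-- The `G`-homomorphism `W → [V^∨, G]^∨` that sends `w` to the restriction of `φ w`. -/
noncomputable def restrictCommutator (φ : σ.IntertwiningMap ρ.dual.dual) :
    σ.IntertwiningMap (commutatorRep ρ.dual).dual :=
  ((commutatorSpace ρ.dual).subtype.dualMap ∘ₗ φ.toLinearMap).intertwiningMap_of_isIntertwiningMap
    _ _ fun g w => LinearMap.ext fun x => congr($(φ.isIntertwining _ _ g w) x)

theorem restrictCommutator_eq_of_extendsEval {ι : ρ.IntertwiningMap σ}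
    (hd : Disjoint (commutatorSpace σ.dual) (LinearMap.ker (dualMap ι).toLinearMap))
    {φ φ' : σ.IntertwiningMap ρ.dual.dual} (hφ : ExtendsEval ι φ) (hφ' : ExtendsEval ι φ') :
    restrictCommutator φ = restrictCommutator φ' :=
  DFunLike.ext _ _ fun w => LinearMap.ext fun x =>
    congr($(section_eqOn_commutatorSpace hd (extendsEval_iff_dualMap_flipDual.1 hφ)
      (extendsEval_iff_dualMap_flipDual.1 hφ') x.2) w)

theorem ker_restrictCommutator {ι : ρ.IntertwiningMap σ}
    (hd : Disjoint (commutatorSpace σ.dual) (LinearMap.ker (dualMap ι).toLinearMap))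
    {φ : σ.IntertwiningMap ρ.dual.dual} (hφ : ExtendsEval ι φ) :
    LinearMap.ker (restrictCommutator φ).toLinearMap = fixedSpace σ := by
  have hmap : (commutatorSpace ρ.dual).map (flipDual φ).toLinearMap = commutatorSpace σ.dual :=
    map_section_commutatorSpace hd (extendsEval_iff_dualMap_flipDual.1 hφ)
  rw [← dualCoannihilator_commutatorSpace_dual, ← hmap]
  ext w
  rw [LinearMap.mem_ker, Submodule.mem_dualCoannihilator, LinearMap.ext_iff]
  constructor
  · rintro h _ ⟨x, hx, rfl⟩
    exact h ⟨x, hx⟩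
  · exact fun h x => h _ ⟨x, x.2, rfl⟩

theorem disjoint_commutatorSpace_dual_dualAnnihilator {𝓛 : Set (Subgroup G)}
    (h𝓛 : IsLocalSystem 𝓛) {U : Submodule k W}
    (hU : ∀ L ∈ 𝓛, U ⊔ fixedSpace (σ.comp L.subtype) = ⊤) :
    Disjoint (commutatorSpace σ.dual) U.dualAnnihilator := by
  refine Submodule.disjoint_def.2 fun x hx hxU => ?_
  obtain ⟨L, hL, hxL⟩ := h𝓛.exists_mem_commutatorSpace hx
  have hfixed : fixedSpace (σ.comp L.subtype) ≤ LinearMap.ker x := by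
    rw [← dualCoannihilator_commutatorSpace_dual]
    exact fun w hw => (Submodule.mem_dualCoannihilator w).1 hw x hxL
  have hle : U ≤ LinearMap.ker x := (Submodule.mem_dualAnnihilator x).1 hxU
  exact LinearMap.ker_eq_top.1 (top_le_iff.1 ((hU L hL).ge.trans (sup_le hle hfixed)))

theorem SplitsOver.range_sup_fixedSpace (hτ : τ.IsTrivial) {ι : ρ.IntertwiningMap σ}
    {π : σ.IntertwiningMap τ} (hexact : Function.Exact ι π) {L : Subgroup G}
    (hL : SplitsOver π L) :
    LinearMap.range ι.toLinearMap ⊔ fixedSpace (σ.comp L.subtype) = ⊤ := by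
  obtain ⟨s, hs⟩ := hL
  refine Submodule.eq_top_iff'.2 fun w => ?_
  have hV : w - s (π w) ∈ LinearMap.range ι.toLinearMap :=
    (hexact _).1 (by rw [map_sub, hs, sub_self])
  have hfixed : s (π w) ∈ fixedSpace (σ.comp L.subtype) := fun g => by
    rw [← s.isIntertwining]
    exact congr(s ($(hτ.out g) (π w)))
  exact Submodule.mem_sup.2 ⟨_, hV, _, hfixed, sub_add_cancel _ _⟩

theorem LocallySplit.disjoint_commutatorSpace_ker_dualMap {𝓛 : Set (Subgroup G)}
    (h𝓛 : IsLocalSystem 𝓛) (hτ : τ.IsTrivial) {ι : ρ.IntertwiningMap σ}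
    {π : σ.IntertwiningMap τ} (hexact : Function.Exact ι π) (hsplit : LocallySplit π 𝓛) :
    Disjoint (commutatorSpace σ.dual) (LinearMap.ker (dualMap ι).toLinearMap) := by
  have hker : LinearMap.ker (dualMap ι).toLinearMap =
      (LinearMap.range ι.toLinearMap).dualAnnihilator :=
    LinearMap.ker_dualMap_eq_dualAnnihilator_range _
  rw [hker]
  exact disjoint_commutatorSpace_dual_dualAnnihilator h𝓛 fun L hL =>
    (hsplit L hL).range_sup_fixedSpace hτ hexact

theorem exists_extendsEval {ι : ρ.IntertwiningMap σ} (hι : Function.Injective ι)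
    (hd : Disjoint (commutatorSpace σ.dual) (LinearMap.ker (dualMap ι).toLinearMap)) :
    ∃ φ : σ.IntertwiningMap ρ.dual.dual, ExtendsEval ι φ := by
  obtain ⟨s, hs⟩ := exists_section_of_disjoint_commutatorSpace
    (LinearMap.dualMap_surjective_of_injective (f := ι.toLinearMap) hι) hd
  exact ⟨flipDual s, extendsEval_iff_dualMap_flipDual.2 hs⟩

end

end LocalCohomology

theorem corollary6 {k G V W Q : Type*} [Field k] [Group G]
    [AddCommGroup V] [Module k V] [AddCommGroup W] [Module k W] [AddCommGroup Q] [Module k Q]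
    (𝓛 : Set (Subgroup G)) (h𝓛 : IsLocalSystem 𝓛)
    (ρ : Representation k G V) (σ : Representation k G W) (τ : Representation k G Q)
    (hτ : τ.IsTrivial)
    (ι : ρ.IntertwiningMap σ) (π : σ.IntertwiningMap τ)
    (hext : IsExtension ι π) (hsplit : LocallySplit π 𝓛) :
    (∃ φ : σ.IntertwiningMap ρ.dual.dual, ExtendsEval ι φ) ∧
    ∃! ψ : (modFixedSpace σ).IntertwiningMap (commutatorRep ρ.dual).dual,
      Function.Injective ψ ∧
      ∀ φ : σ.IntertwiningMap ρ.dual.dual, ExtendsEval ι φ →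
        ∀ (w : W) (x : commutatorSpace ρ.dual),
          ψ (Submodule.Quotient.mk w) x = φ w (x : Module.Dual k V) := by
  have hd := hsplit.disjoint_commutatorSpace_ker_dualMap h𝓛 hτ hext.exact
  obtain ⟨φ, hφ⟩ := exists_extendsEval hext.injective hd
  refine ⟨⟨φ, hφ⟩, (existsUnique_congr fun ψ => and_congr_right fun _ => ?_).2
    (existsUnique_injective_of_ker_eq_fixedSpace (ker_restrictCommutator hd hφ))⟩
  constructor
  · exact fun h w => LinearMap.ext (h φ hφ w)
  · intro h φ' hφ' w x
    rw [h, restrictCommutator_eq_of_extendsEval hd hφ hφ']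
    rfl
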